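/- Let $k\ge 2$ and let $\mathbf{x}=a_0a_1a_2\cdots$ be a $k$-automatic infinite word, i.e., there is a deterministic finite automaton with outputs on its states that, on input the canonical base-$k$ representation of $n$ (most significant digit first, no leading zeros), reaches a state with output $a_n$, for every $n\ge 0$. Write $\mathbf{x}[i..i+n-1]=a_i\cdots a_{i+n-1}$. A nonempty word $w$ is a power if $w=u^m$ for some word $u$ and some integer $m\ge 2$. The occurrence of a length-$n$ factor at position $i$ is novel if $\mathbf{x}[j..j+n-1]\neq \mathbf{x}[i..i+n-1]$ for all $0\le j<i$. Let $P(n)$ be the set of all $i\ge 0$ such that $\mathbf{x}[i..i+n-1]$ is a power and its occurrence at $i$ is novel. Then there is an integer $C$ such that, for every $n\ge 1$, every length-$n$ factor of $\mathbf{x}$ occurs in $\mathbf{x}$ at some position $<Cn$. Moreover, for every integer $C\ge 0$ with this property and every $n\ge 0$, the set $P(n)$ consists of at most $6C$ maximal contiguous blocks (maximal nonempty intervals of integers contained in $P(n)$). In particular, the number of maximal contiguous blocks of $P(n)$ is bounded by a constant independent of $n$. -/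

import Mathlib

/-- The factor `x[i..i+n-1]` of length `n` of the infinite word `x`, starting at position `i`. -/
def wordFactor {A : Type*} (x : ℕ → A) (i n : ℕ) : List A :=
  List.ofFn fun m : Fin n => x (i + m)

/-- A power: a nonempty word of the form `u ^ m` with `m ≥ 2`. -/
def IsPowerWord {A : Type*} (w : List A) : Prop :=
  w ≠ [] ∧ ∃ (u : List A) (m : ℕ), 2 ≤ m ∧ w = (List.replicate m u).flatten

/-- The occurrence at position `i` of a factor of length `n` of `x` is novel: the factor does not
occur at any smaller position. -/
def IsNovelAt {A : Type*} (x : ℕ → A) (n i : ℕ) : Prop :=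
  ∀ j < i, wordFactor x j n ≠ wordFactor x i n

/-- The positions of the novel occurrences of those factors of length `n` that are powers. -/
def novelPowers {A : Type*} (x : ℕ → A) (n : ℕ) : Set ℕ :=
  {i | IsPowerWord (wordFactor x i n) ∧ IsNovelAt x n i}

/-- The maximal contiguous blocks of a set of natural numbers: the maximal nonempty intervals
contained in it. -/
def maximalBlocks (S : Set ℕ) : Set (Set ℕ) :=
  {B | Maximal (fun T : Set ℕ => T.Nonempty ∧ T.OrdConnected ∧ T ⊆ S) B}

/-- The canonical base-`k` representation of `n`, most significant digit first and without leading
zeros (so `0` is represented by the empty word). -/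
def canonicalRep (k : ℕ) (hk : 2 ≤ k) (n : ℕ) : List (Fin k) :=
  ((Nat.digits k n).pmap (fun d (hd : d < k) => (⟨d, hd⟩ : Fin k))
    (fun _ hd => Nat.digits_lt_base hk hd)).reverse

/-- The infinite word `x` is `k`-automatic (`k ≥ 2`): some deterministic finite automaton with
outputs on its states (state set `Q`, initial state `q₀`, transition function `δ`, output function
`τ`) reaches, on input the base-`k` representation of `n`, a state with output `x n`. -/
def IsAutomatic {A : Type*} (k : ℕ) (x : ℕ → A) : Prop :=
  ∃ hk : 2 ≤ k, ∃ (Q : Type) (_ : Finite Q) (q₀ : Q) (δ : Q → Fin k → Q) (τ : Q → A),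
    ∀ n : ℕ, τ ((canonicalRep k hk n).foldl δ q₀) = x n

/-- For every `n ≥ 1`, every factor of length `n` of `x` occurs in `x` at a position `< C * n`. -/
def HasAppearanceConstant {A : Type*} (x : ℕ → A) (C : ℕ) : Prop :=
  ∀ n : ℕ, 1 ≤ n → ∀ i : ℕ, ∃ j < C * n, wordFactor x j n = wordFactor x i n

/-!
Fix `n ≥ 1` and call `i` a power position if the factor of length `n` at `i` is a power, that is, if
it has a period `p ∣ n` with `2 * p ≤ n` (`isPowerWord_wordFactor_iff`).

*Runs of power positions.* If `p` and `q` are such periods, then `p + q - gcd p q ≤ 2 * n / 3`.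
Hence if two power positions are at distance at most `n / 3`, the theorem of Fine and Wilf
(`HasPeriodOn.fine_wilf`) applies to the overlap of their factors, the union of the two factors has
a single period dividing `n`, and every position in between is a power position
(`isPowerWord_of_between`). So the left ends of the maximal intervals of power positions are more
than `n / 3` apart, and so are the right ends; at most `3 * C` of either lie below `C * n`.

*Blocks.* Let `i` be the left end of a maximal block of novel power positions. Either `i` is the left
end of an interval of power positions, or `i - 1` is a power position whose factor has its first
occurrence at some `s < i - 1`. In the second case `s` is the right end of an interval of power
positions: if `s + 1` were a power position, the factors at `s + 1` and at `i` would be the same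
rotation of the common factor at `s` and `i - 1`, although `i` is novel. For the same reason `s`
determines `i`. This gives at most `3 * C + 3 * C` blocks.

*Appearance constant.* With `n ≤ k ^ e ≤ k * n`, a factor of length `n` lies inside two consecutive
aligned blocks of length `k ^ e`, numbered `a` and `a + 1`. For `a ≥ 1` their contents depend only
on the pair of states that the automaton reaches on `a` and `a + 1`. There are finitely many such
pairs, so `a` can be replaced by a bounded number.
-/

/-! ### Periods on intervals -/

/-- The word `x` has period `p` on the half-open interval `[a, b)` of positions. -/
def HasPeriodOn {A : Type*} (x : ℕ → A) (a b p : ℕ) : Prop :=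
  ∀ m, a ≤ m → m + p < b → x m = x (m + p)

theorem HasPeriodOn.mono {A : Type*} {x : ℕ → A} {a b p c d : ℕ} (h : HasPeriodOn x a b p)
    (hc : a ≤ c) (hd : d ≤ b) : HasPeriodOn x c d p :=
  fun m hm hmp => h m (hc.trans hm) (hmp.trans_le hd)

theorem HasPeriodOn.eq_of_modEq {A : Type*} {x : ℕ → A} {a b p : ℕ} (h : HasPeriodOn x a b p)
    {m m' : ℕ} (hm : a ≤ m) (hmb : m < b) (hm' : a ≤ m') (hmb' : m' < b) (hmod : m ≡ m' [MOD p]) :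
    x m = x m' := by
  have key : ∀ t m, a ≤ m → m + p * t < b → x m = x (m + p * t) := by
    intro t
    induction t with
    | zero => intro m _ _; rfl
    | succ t ih =>
      intro m hm hb
      rw [Nat.mul_succ, ← Nat.add_assoc] at hb ⊢
      rw [ih m hm (by omega)]
      exact h _ (by omega) hb
  wlog hle : m ≤ m' generalizing m m'
  · exact (this hm' hmb' hm hmb hmod.symm (by omega)).symm
  obtain ⟨t, ht⟩ := (Nat.modEq_iff_dvd' hle).1 hmod
  obtain rfl : m' = m + p * t := by omega
  exact key t m hm hmb'

/-- A divisor `g` of a period `p` is itself a period as soon as it is one on a window of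
length `p`. -/
theorem HasPeriodOn.extend {A : Type*} {x : ℕ → A} {a b p c e g : ℕ} (h : HasPeriodOn x a b p)
    (hp : 0 < p) (hg : HasPeriodOn x c e g) (hgp : g ∣ p) (hac : a ≤ c) (hce : c + p ≤ e)
    (heb : e ≤ b) : HasPeriodOn x a b g := by
  have rep : ∀ m, ∃ m', c ≤ m' ∧ m' < c + p ∧ m ≡ m' [MOD p] := by
    intro m
    refine ⟨c + (m + c * (p - 1)) % p, by omega, by have := Nat.mod_lt (m + c * (p - 1)) hp; omega,
      ?_⟩
    have h1 : c + (m + c * (p - 1)) % p ≡ c + (m + c * (p - 1)) [MOD p] :=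
      (Nat.mod_modEq _ _).add_left c
    have h2 : c + (m + c * (p - 1)) = m + c * p := by
      obtain ⟨r, rfl⟩ : ∃ r, p = r + 1 := ⟨p - 1, by omega⟩
      simp only [Nat.add_sub_cancel]
      ring
    rw [h2] at h1
    refine (h1.trans ?_).symm
    simp [Nat.ModEq]
  intro m hm hmg
  obtain ⟨m₁, h1, h1', h1''⟩ := rep m
  obtain ⟨m₂, h2, h2', h2''⟩ := rep (m + g)
  rw [h.eq_of_modEq hm (by omega) (by omega) (by omega) h1'',
    h.eq_of_modEq (by omega) hmg (by omega) (by omega) h2'']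
  refine hg.eq_of_modEq h1 (by omega) h2 (by omega) ?_
  refine (h1''.of_dvd hgp).symm.trans (Nat.ModEq.trans ?_ (h2''.of_dvd hgp))
  simp [Nat.ModEq]

/-- The theorem of Fine and Wilf: an interval of length at least `p + q - gcd p q` with periods `p`
and `q` has period `gcd p q`. -/
theorem HasPeriodOn.fine_wilf {A : Type*} {x : ℕ → A} {a b p q : ℕ} (hp : 0 < p) (hq : 0 < q)
    (h : HasPeriodOn x a b p) (h' : HasPeriodOn x a b q) (hL : a + p + q ≤ b + p.gcd q) :
    HasPeriodOn x a b (p.gcd q) := by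
  induction hN : p + q using Nat.strong_induction_on generalizing p q b with
  | _ N ih =>
    wlog hpq : p ≤ q generalizing p q
    · rw [Nat.gcd_comm]
      exact this hq hp h' h (by rw [Nat.gcd_comm]; omega) (by omega) (by omega)
    rcases hpq.eq_or_lt with rfl | hlt
    · simpa using h
    -- one step of the Euclidean algorithm, on the interval shortened by `p`
    have hgcd : p.gcd (q - p) = p.gcd q := Nat.gcd_sub_self_right hpq
    have hle : p.gcd q ≤ q - p := by
      rw [← hgcd]
      exact Nat.le_of_dvd (by omega) (Nat.gcd_dvd_right _ _)
    have hsub : HasPeriodOn x a (b - p) (q - p) := by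
      intro m hm hmb
      rw [h' m hm (by omega), h (m + (q - p)) (by omega) (by omega)]
      congr 1
      omega
    have := ih (p + (q - p)) (by omega) hp (by omega) (h.mono le_rfl (by omega)) hsub
      (by rw [hgcd]; omega) rfl
    rw [hgcd] at this
    exact h.extend hp this (Nat.gcd_dvd_left _ _) le_rfl (by omega) (by omega)

/-! ### Factors that are powers -/

theorem wordFactor_eq_iff {A : Type*} {x : ℕ → A} {i j n : ℕ} :
    wordFactor x i n = wordFactor x j n ↔ ∀ m < n, x (i + m) = x (j + m) := by
  unfold wordFactor
  rw [List.ofFn_inj, funext_iff]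
  exact ⟨fun h m hm => h ⟨m, hm⟩, fun h m => h m m.2⟩

theorem length_wordFactor {A : Type*} (x : ℕ → A) (i n : ℕ) : (wordFactor x i n).length = n := by
  simp [wordFactor]

theorem wordFactor_add {A : Type*} (x : ℕ → A) (i a b : ℕ) :
    wordFactor x i (a + b) = wordFactor x i a ++ wordFactor x (i + a) b := by
  unfold wordFactor
  rw [List.ofFn_add]
  simp [Nat.add_assoc]

theorem isPowerWord_wordFactor_iff {A : Type*} {x : ℕ → A} {i n : ℕ} :
    IsPowerWord (wordFactor x i n) ↔
      ∃ p, 0 < p ∧ p ∣ n ∧ 2 * p ≤ n ∧ HasPeriodOn x i (i + n) p := by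
  constructor
  · rintro ⟨hne, u, m, hm, hw⟩
    have hlen : n = m * u.length := by
      have := congrArg List.length hw
      simpa [length_wordFactor] using this
    have hn : n ≠ 0 := by
      rintro rfl
      exact hne (by simp [wordFactor])
    refine ⟨u.length, Nat.pos_of_ne_zero ?_, ⟨m, by rw [hlen, mul_comm]⟩, ?_, ?_⟩
    · intro h0
      simp [h0] at hlen
      exact hn hlen
    · rw [hlen]
      exact Nat.mul_le_mul_right _ hm
    -- `u ^ m = u * u ^ (m - 1) = u ^ (m - 1) * u`; comparing letters gives the period
    · obtain ⟨r, rfl⟩ : ∃ r, m = r + 1 := ⟨m - 1, by omega⟩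
      set v := (List.replicate r u).flatten with hv
      have h1 : wordFactor x i n = u ++ v := by rw [hw, List.replicate_succ, List.flatten_cons]
      have h2 : wordFactor x i n = v ++ u := by
        rw [hw, List.replicate_succ', List.flatten_append]
        simp [hv]
      have get : ∀ t < n, (wordFactor x i n)[t]? = some (x (i + t)) := by
        intro t ht
        simp [wordFactor, ht]
      have hvl : v.length + u.length = n := by
        rw [← length_wordFactor x i n, h2, List.length_append]
      intro t ht htn
      obtain ⟨t, rfl⟩ := Nat.exists_eq_add_of_le ht
      have e1 := get t (by omega)
      have e2 := get (t + u.length) (by omega)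
      rw [h2, List.getElem?_append_left (by omega)] at e1
      rw [h1, List.getElem?_append_right (by omega), Nat.add_sub_cancel, e1] at e2
      rw [Nat.add_assoc]
      exact Option.some.inj e2
  · rintro ⟨p, hp, ⟨m, rfl⟩, h2, hper⟩
    refine ⟨?_, wordFactor x i p, m, by nlinarith, ?_⟩
    · intro h
      have := congrArg List.length h
      rw [length_wordFactor, List.length_nil] at this
      omega
    · clear h2
      induction m with
      | zero => simp [wordFactor]
      | succ m ih =>
        have hmul : p * (m + 1) = p * m + p := Nat.mul_succ p m
        rw [List.replicate_succ', List.flatten_append,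
          ← ih (hper.mono le_rfl (by omega)), hmul, wordFactor_add]
        congr 1
        simp only [List.flatten_cons, List.flatten_nil, List.append_nil]
        rw [wordFactor_eq_iff]
        intro t ht
        refine hper.eq_of_modEq (by omega) (by omega) (by omega) (by omega) ?_
        rw [Nat.add_assoc, Nat.add_left_comm]
        simp [Nat.ModEq]

/-! ### Intervals of power positions -/

/-- If the windows of length `n` at `i` and `i + d` have periods `p` and `q` dividing `n` and overlap
enough for the theorem of Fine and Wilf, their union has period `gcd p q`. -/
theorem HasPeriodOn.union {A : Type*} {x : ℕ → A} {i d n p q : ℕ} (hp : 0 < p) (hq : 0 < q)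
    (h : HasPeriodOn x i (i + n) p) (h' : HasPeriodOn x (i + d) (i + d + n) q)
    (hL : d + p + q ≤ n + p.gcd q) : HasPeriodOn x i (i + d + n) (p.gcd q) := by
  have hgp := Nat.le_of_dvd hp (Nat.gcd_dvd_left p q)
  have hgq := Nat.le_of_dvd hq (Nat.gcd_dvd_right p q)
  have hov : HasPeriodOn x (i + d) (i + n) (p.gcd q) :=
    fine_wilf hp hq (h.mono (by omega) le_rfl) (h'.mono le_rfl (by omega)) (by omega)
  have h1 := h.extend hp hov (Nat.gcd_dvd_left p q) (by omega) (by omega) le_rfl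
  have h2 := h'.extend hq hov (Nat.gcd_dvd_right p q) le_rfl (by omega) (by omega)
  intro m hm hmg
  by_cases hc : m + p.gcd q < i + n
  · exact h1 m hm hc
  · exact h2 m (by omega) hmg

/-- The extreme case is `p = n / 2`, `q = n / 3`. -/
theorem three_mul_add_le_two_mul_add_gcd {n p q : ℕ} (hp : p ∣ n) (hq : q ∣ n)
    (hp2 : 2 * p ≤ n) (hq2 : 2 * q ≤ n) : 3 * (p + q) ≤ 2 * n + 3 * p.gcd q := by
  wlog hpq : q ≤ p generalizing p q
  · rw [Nat.gcd_comm, add_comm p q]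
    exact this hq hp hq2 hp2 (by omega)
  have third : ∀ r, r ∣ n → 2 * r < n → 3 * r ≤ n := by
    rintro r ⟨b, rfl⟩ h
    have : 2 < b := by
      by_contra hb
      have := Nat.mul_le_mul_left r (not_lt.1 hb)
      omega
    have := Nat.mul_le_mul_left r this
    omega
  rcases hp2.lt_or_eq with hlt | heq
  · have := third p hp hlt
    omega
  rcases hpq.eq_or_lt with rfl | hlt
  · rw [Nat.gcd_self]
    omega
  have h3 := third q hq (by omega)
  -- `q` divides `2 * p = n`, hence `q ∣ 2 * gcd p q`
  have hdvd : q ∣ 2 * p.gcd q := by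
    rw [← Nat.gcd_mul_left]
    exact Nat.dvd_gcd (heq ▸ hq) (dvd_mul_left q 2)
  have hpos : 0 < 2 * p.gcd q := by
    have := Nat.gcd_pos_of_pos_left q (show 0 < p by omega)
    omega
  have := Nat.le_of_dvd hpos hdvd
  omega

/-- Two power positions at distance at most `n / 3` lie in one interval of power positions, on which
the factors share a period dividing `n`. -/
theorem exists_period_of_isPowerWord {A : Type*} {x : ℕ → A} {i d n : ℕ}
    (hi : IsPowerWord (wordFactor x i n)) (hd : IsPowerWord (wordFactor x (i + d) n))
    (hdn : 3 * d ≤ n) :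
    ∃ g, 0 < g ∧ g ∣ n ∧ 2 * g ≤ n ∧ HasPeriodOn x i (i + d + n) g := by
  obtain ⟨p, hp, hpn, hp2, hper⟩ := isPowerWord_wordFactor_iff.1 hi
  obtain ⟨q, hq, hqn, hq2, hper'⟩ := isPowerWord_wordFactor_iff.1 hd
  have hgp := Nat.le_of_dvd hp (Nat.gcd_dvd_left p q)
  have := three_mul_add_le_two_mul_add_gcd hpn hqn hp2 hq2
  exact ⟨p.gcd q, Nat.gcd_pos_of_pos_left q hp, (Nat.gcd_dvd_left p q).trans hpn, by omega,
    hper.union hp hq hper' (by omega)⟩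

theorem isPowerWord_of_between {A : Type*} {x : ℕ → A} {i j t n : ℕ}
    (hi : IsPowerWord (wordFactor x i n)) (hj : IsPowerWord (wordFactor x j n))
    (hij : 3 * (j - i) ≤ n) (hit : i ≤ t) (htj : t ≤ j) : IsPowerWord (wordFactor x t n) := by
  obtain ⟨d, rfl⟩ := Nat.exists_eq_add_of_le (hit.trans htj)
  obtain ⟨g, hg, hgn, hg2, h⟩ := exists_period_of_isPowerWord hi hj (by omega)
  exact isPowerWord_wordFactor_iff.2 ⟨g, hg, hgn, hg2, h.mono hit (by omega)⟩

/-- If `i` and `i + 1` are power positions, the factor at `i + 1` is the rotation of the factor at `i`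
by one letter. -/
theorem apply_add_eq_of_isPowerWord_succ {A : Type*} {x : ℕ → A} {i n : ℕ}
    (h : IsPowerWord (wordFactor x i n)) (h' : IsPowerWord (wordFactor x (i + 1) n)) :
    x (i + n) = x i := by
  obtain ⟨g, hg, hgn, hper⟩ : ∃ g, 0 < g ∧ g ∣ n ∧ HasPeriodOn x i (i + 1 + n) g := by
    rcases le_or_gt 3 n with hn | hn
    · obtain ⟨g, hg, hgn, -, hper⟩ := exists_period_of_isPowerWord h h' (by omega)
      exact ⟨g, hg, hgn, hper⟩
    -- for `n = 2`, where `1 > n / 3`, both factors have period `1`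
    · obtain ⟨p, hp, hpn, hp2, hper⟩ := isPowerWord_wordFactor_iff.1 h
      obtain ⟨q, hq, hqn, hq2, hper'⟩ := isPowerWord_wordFactor_iff.1 h'
      obtain rfl : p = 1 := by omega
      obtain rfl : q = 1 := by omega
      exact ⟨1, one_pos, one_dvd n, hper.union one_pos one_pos hper' (by simp; omega)⟩
  refine hper.eq_of_modEq (by omega) (by omega) le_rfl (by omega) ?_
  exact (Nat.modEq_zero_iff_dvd.2 hgn).add_left i

theorem wordFactor_succ_eq_of_isPowerWord {A : Type*} {x : ℕ → A} {s t n : ℕ}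
    (hs : IsPowerWord (wordFactor x s n)) (hs' : IsPowerWord (wordFactor x (s + 1) n))
    (ht : IsPowerWord (wordFactor x t n)) (ht' : IsPowerWord (wordFactor x (t + 1) n))
    (h : wordFactor x s n = wordFactor x t n) :
    wordFactor x (s + 1) n = wordFactor x (t + 1) n := by
  rw [wordFactor_eq_iff] at h ⊢
  intro m hm
  rw [Nat.add_assoc, Nat.add_assoc, Nat.add_comm 1 m]
  rcases Nat.lt_or_ge (m + 1) n with hlt | hge
  · exact h _ hlt
  · obtain rfl : m + 1 = n := by omega
    rw [apply_add_eq_of_isPowerWord_succ hs hs', apply_add_eq_of_isPowerWord_succ ht ht']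
    simpa using h 0 (by omega)

/-! ### Counting blocks -/

theorem encard_le_of_separated {S : Set ℕ} {C n : ℕ} (hn : 0 < n) (hlt : ∀ i ∈ S, i < C * n)
    (hsep : ∀ i ∈ S, ∀ j ∈ S, i < j → n < 3 * (j - i)) : S.encard ≤ ((3 * C : ℕ) : ℕ∞) := by
  have hmono : ∀ i ∈ S, ∀ j ∈ S, i < j → 3 * i / n < 3 * j / n := by
    intro i hi j hj hij
    have := hsep i hi j hj hij
    calc 3 * i / n < 3 * i / n + 1 := Nat.lt_succ_self _
      _ = (3 * i + n) / n := (Nat.add_div_right _ hn).symm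
      _ ≤ 3 * j / n := Nat.div_le_div_right (by omega)
  have hinj : Set.InjOn (fun i => 3 * i / n) S := by
    intro i hi j hj hij
    rcases lt_trichotomy i j with h | h | h
    · exact absurd hij (hmono i hi j hj h).ne
    · exact h
    · exact absurd hij (hmono j hj i hi h).ne'
  have hmaps : Set.MapsTo (fun i => 3 * i / n) S (Finset.range (3 * C) : Set ℕ) := by
    intro i hi
    have := hlt i hi
    simp only [Finset.coe_range, Set.mem_Iio]
    rw [Nat.div_lt_iff_lt_mul hn, Nat.mul_assoc]
    omega
  refine (Set.encard_le_encard_of_injOn hmaps hinj).trans ?_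
  rw [Set.encard_coe_eq_coe_finsetCard, Finset.card_range]

theorem mem_maximalBlocks {S B : Set ℕ} :
    B ∈ maximalBlocks S ↔ Maximal (fun T : Set ℕ => T.Nonempty ∧ T.OrdConnected ∧ T ⊆ S) B :=
  Iff.rfl

theorem eq_of_mem_maximalBlocks {S B B' : Set ℕ} (hB : B ∈ maximalBlocks S)
    (hB' : B' ∈ maximalBlocks S) {i : ℕ} (hi : i ∈ B) (hi' : i ∈ B') : B = B' := by
  rw [mem_maximalBlocks] at hB hB'
  have hU : (B ∪ B').Nonempty ∧ (B ∪ B').OrdConnected ∧ B ∪ B' ⊆ S := by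
    refine ⟨⟨i, Or.inl hi⟩, ?_, Set.union_subset hB.prop.2.2 hB'.prop.2.2⟩
    have h1 := hB.prop.2.1
    have h2 := hB'.prop.2.1
    constructor
    rintro a ha b hb t ⟨hat, htb⟩
    rcases le_total t i with hti | hti
    · rcases ha with ha | ha
      · exact Or.inl (h1.out ha hi ⟨hat, hti⟩)
      · exact Or.inr (h2.out ha hi' ⟨hat, hti⟩)
    · rcases hb with hb | hb
      · exact Or.inl (h1.out hi hb ⟨hti, htb⟩)
      · exact Or.inr (h2.out hi' hb ⟨hti, htb⟩)
  rw [hB.eq_of_subset hU Set.subset_union_left]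
  exact (hB'.eq_of_subset hU Set.subset_union_right).symm

theorem encard_maximalBlocks_le (S : Set ℕ) :
    (maximalBlocks S).encard ≤ {i | i ∈ S ∧ ∀ j, j + 1 = i → j ∉ S}.encard := by
  refine Set.encard_le_encard_of_injOn (f := sInf) ?_ ?_
  · intro B hB
    rw [mem_maximalBlocks] at hB
    have hmem := Nat.sInf_mem hB.prop.1
    refine ⟨hB.prop.2.2 hmem, fun j hj hjS => ?_⟩
    have hins : (insert j B).Nonempty ∧ (insert j B).OrdConnected ∧ insert j B ⊆ S := by
      refine ⟨⟨j, Or.inl rfl⟩, ?_, Set.insert_subset hjS hB.prop.2.2⟩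
      have h1 := hB.prop.2.1
      have low : ∀ a ∈ insert j B, j ≤ a := by
        rintro a (rfl | ha)
        · exact le_rfl
        · have := Nat.sInf_le ha
          omega
      constructor
      rintro a ha b hb t ⟨hat, htb⟩
      rcases (low a ha |>.trans hat).eq_or_lt with rfl | hjt
      · exact Or.inl rfl
      · rcases hb with rfl | hb
        · omega
        · exact Or.inr (h1.out hmem hb ⟨by omega, htb⟩)
    have hjB : j ∈ B := by
      rw [hB.eq_of_subset hins (Set.subset_insert j B)]
      exact Or.inl rfl
    have := Nat.sInf_le hjB
    omega
  · intro B hB B' hB' h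
    refine eq_of_mem_maximalBlocks hB hB' (Nat.sInf_mem (mem_maximalBlocks.1 hB).prop.1) ?_
    rw [show sInf B = sInf B' from h]
    exact Nat.sInf_mem (mem_maximalBlocks.1 hB').prop.1

theorem exists_isNovelAt {A : Type*} (x : ℕ → A) (n i : ℕ) :
    ∃ s ≤ i, wordFactor x s n = wordFactor x i n ∧ IsNovelAt x n s := by
  classical
  have hex : ∃ s, wordFactor x s n = wordFactor x i n := ⟨i, rfl⟩
  refine ⟨Nat.find hex, Nat.find_min' hex rfl, Nat.find_spec hex, fun j hj h => ?_⟩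
  exact Nat.find_min hex hj (h.trans (Nat.find_spec hex))

theorem IsNovelAt.le_of_eq {A : Type*} {x : ℕ → A} {n i j : ℕ} (h : IsNovelAt x n i)
    (hij : wordFactor x j n = wordFactor x i n) : i ≤ j :=
  not_lt.1 fun hlt => h j hlt hij

theorem IsNovelAt.lt_of_hasAppearanceConstant {A : Type*} {x : ℕ → A} {n i C : ℕ}
    (h : IsNovelAt x n i) (hC : HasAppearanceConstant x C) (hn : 1 ≤ n) : i < C * n := by
  obtain ⟨j, hj, hji⟩ := hC n hn i
  exact (h.le_of_eq hji).trans_lt hj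

theorem encard_maximalBlocks_novelPowers_le {A : Type*} {x : ℕ → A} {C : ℕ}
    (hC : HasAppearanceConstant x C) (n : ℕ) :
    (maximalBlocks (novelPowers x n)).encard ≤ ((6 * C : ℕ) : ℕ∞) := by
  refine (encard_maximalBlocks_le _).trans ?_
  rcases Nat.eq_zero_or_pos n with rfl | hn
  · have : {i | i ∈ novelPowers x 0 ∧ ∀ j, j + 1 = i → j ∉ novelPowers x 0} = ∅ := by
      rw [Set.eq_empty_iff_forall_notMem]
      rintro i ⟨⟨⟨hne, -⟩, -⟩, -⟩
      exact hne (by simp [wordFactor])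
    simp [this]
  set P : ℕ → Prop := fun i => IsPowerWord (wordFactor x i n) with hP
  -- left and right ends of the maximal intervals of power positions
  set L : Set ℕ := {i | P i ∧ i < C * n ∧ ∀ j, j + 1 = i → ¬ P j}
  set R : Set ℕ := {s | P s ∧ s < C * n ∧ ¬ P (s + 1)}
  have hL : L.encard ≤ ((3 * C : ℕ) : ℕ∞) := by
    refine encard_le_of_separated hn (fun i hi => hi.2.1) fun i hi j hj hij => ?_
    by_contra hd
    exact hj.2.2 (j - 1) (by omega)
      (isPowerWord_of_between hi.1 hj.1 (not_lt.1 hd) (by omega) (by omega))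
  have hR : R.encard ≤ ((3 * C : ℕ) : ℕ∞) := by
    refine encard_le_of_separated hn (fun i hi => hi.2.1) fun i hi j hj hij => ?_
    by_contra hd
    exact hi.2.2 (isPowerWord_of_between hi.1 hj.1 (not_lt.1 hd) (by omega) (by omega))
  set T : Set ℕ := {i | i ∈ novelPowers x n ∧ ∃ j, j + 1 = i ∧ P j ∧ ¬ IsNovelAt x n j}
  -- a block starting in `T` is charged to the first occurrence of the factor just before it
  have hTR : T.encard ≤ R.encard := by
    choose f hfle hfeq hfnov using exists_isNovelAt x n
    refine Set.encard_le_encard_of_injOn (f := fun i => f (i - 1)) ?_ ?_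
    · rintro i ⟨⟨hPi, hnov⟩, j, rfl, hPj, hjn⟩
      simp only [Nat.add_sub_cancel]
      have hPf : P (f j) := by
        simp only [hP]
        rw [hfeq]
        exact hPj
      refine ⟨hPf, (hfnov j).lt_of_hasAppearanceConstant hC hn, fun hPf' => ?_⟩
      have h := hnov.le_of_eq (wordFactor_succ_eq_of_isPowerWord hPf hPf' hPj hPi (hfeq j))
      have heq : f j = j := le_antisymm (hfle j) (by omega)
      exact hjn (heq ▸ hfnov j)
    · rintro i ⟨⟨hPi, hnov⟩, j, rfl, hPj, -⟩ i' ⟨⟨hPi', hnov'⟩, j', rfl, hPj', -⟩ h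
      simp only [Nat.add_sub_cancel] at h
      have hw : wordFactor x j n = wordFactor x j' n := by rw [← hfeq j, h, hfeq j']
      have hw' := wordFactor_succ_eq_of_isPowerWord hPj hPi hPj' hPi' hw
      exact le_antisymm (hnov.le_of_eq hw'.symm) (hnov'.le_of_eq hw')
  have hsub : {i | i ∈ novelPowers x n ∧ ∀ j, j + 1 = i → j ∉ novelPowers x n} ⊆ L ∪ T := by
    rintro i ⟨hi, hstart⟩
    by_cases h : ∃ j, j + 1 = i ∧ P j
    · obtain ⟨j, hj, hPj⟩ := h
      exact Or.inr ⟨hi, j, hj, hPj, fun hnov => hstart j hj ⟨hPj, hnov⟩⟩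
    · exact Or.inl ⟨hi.1, hi.2.lt_of_hasAppearanceConstant hC hn, fun j hj hPj => h ⟨j, hj, hPj⟩⟩
  calc _ ≤ (L ∪ T).encard := Set.encard_le_encard hsub
    _ ≤ L.encard + T.encard := Set.encard_union_le _ _
    _ ≤ ((3 * C : ℕ) : ℕ∞) + ((3 * C : ℕ) : ℕ∞) := add_le_add hL (hTR.trans hR)
    _ = ((6 * C : ℕ) : ℕ∞) := by
      rw [← Nat.cast_add]
      congr 1
      omega

/-! ### Automatic words have an appearance constant -/

theorem canonicalRep_mul_add {k : ℕ} (hk : 2 ≤ k) {a : ℕ} (ha : 1 ≤ a) (d : Fin k) :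
    canonicalRep k hk (k * a + d) = canonicalRep k hk a ++ [d] := by
  have hdig : Nat.digits k (k * a + d) = (d : ℕ) :: Nat.digits k a := by
    rw [Nat.add_comm]
    exact Nat.digits_add k (by omega) d a d.2 (Or.inr (by omega))
  have aux : ∀ (l l' : List ℕ) (_ : l = l') (H : ∀ d ∈ l, d < k) (H' : ∀ d ∈ l', d < k),
      l.pmap (fun d (hd : d < k) => (⟨d, hd⟩ : Fin k)) H =
        l'.pmap (fun d (hd : d < k) => (⟨d, hd⟩ : Fin k)) H' := by
    rintro l _ rfl H H'
    rfl
  unfold canonicalRep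
  rw [aux _ _ hdig _ (fun e he => Nat.digits_lt_base hk (hdig ▸ he)), List.pmap_cons,
    List.reverse_cons]

/-- The states reached inside the block `[a * k ^ e, (a + 1) * k ^ e)` depend only on the state
reached on `a`. The block `a = 0` is excluded, since representations have no leading zeros. -/
theorem foldl_canonicalRep_eq {k : ℕ} (hk : 2 ≤ k) {Q : Type*} {q₀ : Q} {δ : Q → Fin k → Q}
    {a b : ℕ} (ha : 1 ≤ a) (hb : 1 ≤ b)
    (hab : (canonicalRep k hk a).foldl δ q₀ = (canonicalRep k hk b).foldl δ q₀) (e : ℕ) :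
    ∀ r < k ^ e, (canonicalRep k hk (a * k ^ e + r)).foldl δ q₀ =
      (canonicalRep k hk (b * k ^ e + r)).foldl δ q₀ := by
  have hk0 : 0 < k := by omega
  induction e with
  | zero =>
    intro r hr
    obtain rfl : r = 0 := by simpa using hr
    simpa using hab
  | succ e ih =>
    intro r hr
    have hr' : r / k < k ^ e := by
      rw [Nat.div_lt_iff_lt_mul hk0, ← pow_succ]
      exact hr
    have split : ∀ c, c * k ^ (e + 1) + r = k * (c * k ^ e + r / k) + r % k := by
      intro c
      conv_lhs => rw [← Nat.div_add_mod r k]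
      ring
    have pos : ∀ c, 1 ≤ c → 1 ≤ c * k ^ e + r / k := fun c hc =>
      le_add_right (Nat.mul_pos hc (pow_pos hk0 e))
    have hstep := fun c hc =>
      canonicalRep_mul_add hk (pos c hc) (⟨r % k, Nat.mod_lt r hk0⟩ : Fin k)
    simp only at hstep
    rw [split, split, hstep a ha, hstep b hb, List.foldl_append, List.foldl_append, ih _ hr']

theorem exists_bounded_preimage {Q : Type*} [Finite Q] (f : ℕ → Q) :
    ∃ N, ∀ a, 1 ≤ a → ∃ b, 1 ≤ b ∧ b ≤ N ∧ f b = f a := by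
  choose g hg using fun q : f '' Set.Ici 1 => q.2
  obtain ⟨N, hN⟩ := (Set.finite_range g).bddAbove
  exact ⟨N, fun a ha => ⟨g ⟨f a, a, ha, rfl⟩, (hg _).1, hN ⟨_, rfl⟩, (hg _).2⟩⟩

theorem IsAutomatic.exists_hasAppearanceConstant {A : Type*} {k : ℕ} {x : ℕ → A}
    (hx : IsAutomatic k x) : ∃ C, HasAppearanceConstant x C := by
  obtain ⟨hk, Q, hQ, q₀, δ, τ, hτ⟩ := hx
  set st : ℕ → Q := fun n => (canonicalRep k hk n).foldl δ q₀
  obtain ⟨N, hN⟩ := exists_bounded_preimage fun a => (st a, st (a + 1))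
  refine ⟨(N + 1) * k, fun n hn i => ?_⟩
  obtain ⟨e, hne, hek⟩ : ∃ e, n ≤ k ^ e ∧ k ^ e ≤ k * n := by
    rcases hn.eq_or_lt with rfl | hn1
    · exact ⟨0, by simp, by simp; omega⟩
    · refine ⟨Nat.clog k n, Nat.le_pow_clog (by omega) n, ?_⟩
      have h1 := Nat.pow_pred_clog_lt_self (b := k) (by omega) hn1
      have h2 : 0 < Nat.clog k n := Nat.clog_pos (by omega) hn1
      obtain ⟨c, hc⟩ : ∃ c, Nat.clog k n = c + 1 := ⟨Nat.clog k n - 1, by omega⟩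
      rw [hc] at h1 ⊢
      rw [pow_succ, mul_comm]
      exact Nat.mul_le_mul_left k h1.le
  have hK : 0 < k ^ e := by omega
  have hr := Nat.mod_lt i hK
  have hdm : i = i / k ^ e * k ^ e + i % k ^ e := (Nat.div_add_mod' i _).symm
  set a := i / k ^ e
  set r := i % k ^ e
  have bound : ∀ b ≤ N, b * k ^ e + r < (N + 1) * k * n := by
    intro b hb
    calc b * k ^ e + r < b * k ^ e + k ^ e := by omega
      _ = (b + 1) * k ^ e := (Nat.succ_mul _ _).symm
      _ ≤ (N + 1) * (k * n) := Nat.mul_le_mul (by omega) hek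
      _ = (N + 1) * k * n := (Nat.mul_assoc _ _ _).symm
  rcases Nat.eq_zero_or_pos a with h0 | hpos
  · refine ⟨i, ?_, rfl⟩
    have := bound 0 (Nat.zero_le N)
    rw [h0] at hdm
    omega
  obtain ⟨b, hb1, hbN, hba⟩ := hN a hpos
  obtain ⟨hba1, hba2⟩ := Prod.mk.inj hba
  refine ⟨b * k ^ e + r, bound b hbN, ?_⟩
  rw [wordFactor_eq_iff]
  intro m hm
  rw [hdm, ← hτ, ← hτ, Nat.add_assoc, Nat.add_assoc]
  rcases Nat.lt_or_ge (r + m) (k ^ e) with hlt | hge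
  · rw [foldl_canonicalRep_eq hk hb1 hpos hba1 e _ hlt]
  · obtain ⟨t, ht⟩ := Nat.exists_eq_add_of_le hge
    have := foldl_canonicalRep_eq hk (by omega) (by omega) hba2 e t (by omega)
    rw [Nat.succ_mul, Nat.succ_mul, Nat.add_assoc, Nat.add_assoc, ← ht] at this
    rw [this]

theorem mainTheorem8 {A : Type*} (k : ℕ) (x : ℕ → A) (hx : IsAutomatic k x) :
    (∃ C : ℕ, HasAppearanceConstant x C) ∧
      ∀ C : ℕ, HasAppearanceConstant x C →
        ∀ n : ℕ, (maximalBlocks (novelPowers x n)).encard ≤ ((6 * C : ℕ) : ℕ∞) :=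
  ⟨hx.exists_hasAppearanceConstant, fun _ hC n => encard_maximalBlocks_novelPowers_le hC n⟩
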